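/- Let $L=(L_t)_{t\ge 0}$ be a real-valued Lévy process, i.e. a process with $L_0=0$ almost surely, with stationary increments ($L_s$ and $L_{t+s}-L_t$ have the same law for all $s,t\ge 0$), with independent increments (for all $0\le t_0\le t_1\le\dots\le t_n$ the variables $L_{t_k}-L_{t_{k-1}}$, $1\le k\le n$, are mutually independent), and with almost surely right-continuous sample paths having left limits. Suppose that for every $t>0$ the variable $L_t$ has finite differential entropy, i.e. its law has a density $p_{L_t}$ with respect to the Lebesgue measure and $p_{L_t}\log p_{L_t}$ is absolutely integrable on $\mathbb{R}$ (with $0\log 0=0$), and write $$h(L_t)=-\int_{\mathbb{R}}p_{L_t}(x)\log p_{L_t}(x)\,\mathrm{d}x .$$ Then: 1. the function $t\mapsto h(L_t)$ is non-decreasing on $(0,\infty)$; 2. $h(L_t)\le h(L_1)+\frac12\log\frac{t}{1-t}$ for all $t\in(0,1)$. -/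

import Mathlib

open MeasureTheory ProbabilityTheory Filter Set
open scoped NNReal ENNReal Topology

/-- A real-valued stochastic process `L = (L_t)_{t ≥ 0}` on the probability space `(Ω, P)` is a
Lévy process if it starts at zero almost surely, has stationary and independent increments, and
its sample paths are almost surely right-continuous with left limits. -/
structure IsLevyProcess {Ω : Type*} [MeasurableSpace Ω] (L : ℝ≥0 → Ω → ℝ) (P : Measure Ω) :
    Prop where
  measurable : ∀ t, Measurable (L t)
  zero : ∀ᵐ ω ∂P, L 0 ω = 0
  stationary : ∀ s t : ℝ≥0, IdentDistrib (L s) (fun ω => L (t + s) ω - L t ω) P P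
  indep : HasIndepIncrements L P
  cadlag : ∀ᵐ ω ∂P, ∀ t : ℝ≥0,
    ContinuousWithinAt (fun s => L s ω) (Ici t) t ∧
      ∃ l : ℝ, Tendsto (fun s => L s ω) (𝓝[<] t) (𝓝 l)

/-- The probability density function of `X` with respect to the Lebesgue measure, as a
real-valued function (meaningful when the law of `X` is absolutely continuous). -/
noncomputable def realDensity {Ω : Type*} [MeasurableSpace Ω] (X : Ω → ℝ) (P : Measure Ω) :
    ℝ → ℝ :=
  fun x => (pdf X P volume x).toReal

/-- `X` has finite differential entropy: its law is absolutely continuous with respect to the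
Lebesgue measure, and `p log p` is absolutely integrable, where `p` is its density. -/
def HasFiniteDifferentialEntropy {Ω : Type*} [MeasurableSpace Ω] (X : Ω → ℝ) (P : Measure Ω) :
    Prop :=
  HasPDF X P volume ∧
    Integrable (fun x => realDensity X P x * Real.log (realDensity X P x)) volume

/-- The differential entropy `h(X) = -∫ p(x) log p(x) dx`, where `p` is the density of `X`; it is
used only for random variables satisfying `HasFiniteDifferentialEntropy`. -/
noncomputable def differentialEntropy {Ω : Type*} [MeasurableSpace Ω] (X : Ω → ℝ)
    (P : Measure Ω) : ℝ :=
  -∫ x, realDensity X P x * Real.log (realDensity X P x)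

/-! Since the law of L_{s+t} is the convolution of those of L_s and L_t, both claims are entropy
inequalities for convolutions. Adding an independent variable cannot lower entropy
(`integral_llr_conv_le`); this is monotonicity. The linearised entropy power inequality
(`integral_llr_conv_le_weighted`) yields h(L_{nt}) ≥ h(L_t) + ½ log n by induction. For n = ⌊1/t⌋
one has nt ≤ 1 and n ≥ (1 - t)/t, so monotonicity up to time 1 gives the bound.

Both inequalities come from Gibbs' principle: ∫ exp u ≤ 1 forces ∫ u ≤ 0. For the second, the
summands are written T₁(Z₁) and T₂(Z₂), with T₁, T₂ increasing and (Z₁, Z₂) an orthogonal image of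
independent standard Gaussians (X, Y). For fixed Y the sum is increasing in X; concavity of log
bounds its derivative from below, and a change of variables in X bounds the exponential integral. -/

/-! ### Gibbs' inequality and entropy under convolution -/

theorem integral_nonpos_of_lintegral_exp_le_one {α : Type*} [MeasurableSpace α] {μ : Measure α}
    [IsProbabilityMeasure μ] {u : α → ℝ} (hu : Integrable u μ)
    (h : ∫⁻ x, ENNReal.ofReal (Real.exp (u x)) ∂μ ≤ 1) : ∫ x, u x ∂μ ≤ 0 := by
  have hm : AEStronglyMeasurable (fun x => Real.exp (u x)) μ :=
    Real.continuous_exp.comp_aestronglyMeasurable hu.1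
  have hi : Integrable (fun x => Real.exp (u x)) μ := by
    refine ⟨hm, ?_⟩
    rw [hasFiniteIntegral_iff_ofReal (ae_of_all _ fun x => (Real.exp_pos _).le)]
    exact h.trans_lt ENNReal.one_lt_top
  have h1 : ∫ x, Real.exp (u x) ∂μ ≤ 1 := by
    rw [integral_eq_lintegral_of_nonneg_ae (ae_of_all _ fun x => (Real.exp_pos _).le) hm]
    exact ENNReal.toReal_le_of_le_ofReal zero_le_one (by simpa using h)
  have h2 : ∫ x, (u x + 1) ∂μ ≤ ∫ x, Real.exp (u x) ∂μ :=
    integral_mono (hu.add (integrable_const 1)) hi fun x => Real.add_one_le_exp _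
  rw [integral_add hu (integrable_const 1)] at h2
  simp at h2
  linarith

theorem MeasureTheory.MeasurePreserving.integral_comp_of_measurable {α β : Type*}
    [MeasurableSpace α] [MeasurableSpace β] {μ : Measure α} {ν : Measure β} {f : α → β}
    (hf : MeasurePreserving f μ ν) {g : β → ℝ} (hg : Measurable g) :
    ∫ x, g (f x) ∂μ = ∫ y, g y ∂ν := by
  rw [← hf.map_eq, integral_map hf.measurable.aemeasurable hg.aestronglyMeasurable]

/-- The density cancels wherever it is positive and finite; where it vanishes, mass of `ν` is lost,
hence only an inequality. -/
theorem lintegral_div_rnDeriv_le {α : Type*} [MeasurableSpace α] {μ ν : Measure α}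
    [μ.HaveLebesgueDecomposition ν] [SigmaFinite μ] (hμν : μ ≪ ν) {f : α → ℝ≥0∞}
    (hf : Measurable f) :
    ∫⁻ x, f x / μ.rnDeriv ν x ∂μ ≤ ∫⁻ x, f x ∂ν := by
  rw [← lintegral_rnDeriv_mul hμν
    (show Measurable fun x => f x / μ.rnDeriv ν x from
      hf.div (Measure.measurable_rnDeriv μ ν)).aemeasurable]
  exact lintegral_mono fun x => ENNReal.mul_div_le

theorem ae_rnDeriv_pos_lt_top {α : Type*} [MeasurableSpace α] {μ ν : Measure α}
    [μ.HaveLebesgueDecomposition ν] [SigmaFinite μ] (hμν : μ ≪ ν) :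
    ∀ᵐ x ∂μ, 0 < μ.rnDeriv ν x ∧ μ.rnDeriv ν x < ∞ :=
  (Measure.rnDeriv_pos hμν).and (hμν.ae_le (Measure.rnDeriv_lt_top μ ν))

/-- Adding an independent variable does not decrease the differential entropy. -/
theorem integral_llr_conv_le {μ ν : Measure ℝ} [IsProbabilityMeasure μ] [IsProbabilityMeasure ν]
    (hμ : μ ≪ volume) (hμν : μ ∗ ν ≪ volume) (hi : Integrable (llr μ volume) μ)
    (hi' : Integrable (llr (μ ∗ ν) volume) (μ ∗ ν)) :
    ∫ x, llr (μ ∗ ν) volume x ∂(μ ∗ ν) ≤ ∫ x, llr μ volume x ∂μ := by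
  have hadd : MeasurePreserving (fun p : ℝ × ℝ => p.1 + p.2) (μ.prod ν) (μ ∗ ν) :=
    ⟨by fun_prop, rfl⟩
  have hfst : MeasurePreserving Prod.fst (μ.prod ν) μ := measurePreserving_fst
  have i1 : Integrable (fun p : ℝ × ℝ => llr (μ ∗ ν) volume (p.1 + p.2)) (μ.prod ν) :=
    hadd.integrable_comp_of_integrable hi'
  have i2 : Integrable (fun p : ℝ × ℝ => llr μ volume p.1) (μ.prod ν) :=
    hfst.integrable_comp_of_integrable hi
  rw [← sub_nonpos, ← hadd.integral_comp_of_measurable (measurable_llr _ _),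
    ← hfst.integral_comp_of_measurable (measurable_llr _ _), ← integral_sub i1 i2]
  refine integral_nonpos_of_lintegral_exp_le_one (i1.sub i2) ?_
  have hg : Measurable ((μ ∗ ν).rnDeriv volume) := Measure.measurable_rnDeriv _ _
  have hf : Measurable (μ.rnDeriv volume) := Measure.measurable_rnDeriv _ _
  calc ∫⁻ p : ℝ × ℝ, ENNReal.ofReal (Real.exp
          (llr (μ ∗ ν) volume (p.1 + p.2) - llr μ volume p.1)) ∂(μ.prod ν)
      = ∫⁻ p : ℝ × ℝ, (μ ∗ ν).rnDeriv volume (p.1 + p.2) / μ.rnDeriv volume p.1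
          ∂(μ.prod ν) := by
        refine lintegral_congr_ae ?_
        filter_upwards [hadd.quasiMeasurePreserving.ae (ae_rnDeriv_pos_lt_top hμν),
          hfst.quasiMeasurePreserving.ae (ae_rnDeriv_pos_lt_top hμ)] with p h1 h2
        have h1' := ENNReal.toReal_pos h1.1.ne' h1.2.ne
        have h2' := ENNReal.toReal_pos h2.1.ne' h2.2.ne
        rw [Real.exp_sub, llr, llr, Real.exp_log h1', Real.exp_log h2',
          ENNReal.ofReal_div_of_pos h2', ENNReal.ofReal_toReal h1.2.ne,
          ENNReal.ofReal_toReal h2.2.ne]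
    _ = ∫⁻ y, ∫⁻ x, (μ ∗ ν).rnDeriv volume (x + y) / μ.rnDeriv volume x ∂μ ∂ν :=
        lintegral_prod_symm' _ (by fun_prop)
    _ ≤ ∫⁻ y, (∫⁻ x, (μ ∗ ν).rnDeriv volume (x + y)) ∂ν := by
        refine lintegral_mono fun y => lintegral_div_rnDeriv_le hμ (by fun_prop)
    _ = ∫⁻ y, (∫⁻ x, (μ ∗ ν).rnDeriv volume x) ∂ν := by
        -- Lebesgue measure is translation invariant.
        simp_rw [lintegral_add_right_eq_self]
    _ ≤ 1 := by
        rw [lintegral_const, measure_univ, mul_one]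
        exact Measure.lintegral_rnDeriv_le.trans_eq measure_univ

/-! ### Monotone transport and change of variables -/

theorem continuous_cdf (μ : Measure ℝ) [IsProbabilityMeasure μ] [NullSingletonClass μ] :
    Continuous (cdf μ) := by
  rw [continuous_iff_continuousAt]
  intro x
  rw [(cdf μ).mono.continuousAt_iff_leftLim_eq_rightLim, (cdf μ).rightLim_eq]
  have h := (cdf μ).measure_singleton x
  rw [measure_cdf, measure_singleton] at h
  have := ENNReal.ofReal_eq_zero.1 h.symm
  exact le_antisymm ((cdf μ).mono.leftLim_le le_rfl) (by linarith)

theorem exists_cdf_eq (μ : Measure ℝ) [IsProbabilityMeasure μ] [NullSingletonClass μ] {p : ℝ}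
    (h0 : 0 < p) (h1 : p < 1) : ∃ x, cdf μ x = p := by
  obtain ⟨a, ha⟩ := ((tendsto_cdf_atBot μ).eventually_lt_const h0).exists
  obtain ⟨b, hb⟩ := ((tendsto_cdf_atTop μ).eventually_const_lt h1).exists
  exact mem_range_of_exists_le_of_exists_ge (continuous_cdf μ) ⟨a, ha.le⟩ ⟨b, hb.le⟩

theorem strictMono_cdf {ν : Measure ℝ} [IsProbabilityMeasure ν] (hν : volume ≪ ν) :
    StrictMono (cdf ν) := by
  intro x y hxy
  refine lt_of_le_of_ne ((cdf ν).mono hxy.le) fun h => ?_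
  have h1 : ν (Ioc x y) = 0 := by
    rw [← measure_cdf ν, StieltjesFunction.measure_Ioc, h]; simp
  have h2 := hν h1
  simp only [Real.volume_Ioc, ENNReal.ofReal_eq_zero] at h2
  linarith

/-- Monotone transport between laws on the line, with its Monge-Ampère equation. -/
theorem exists_strictMono_transport {ν μ : Measure ℝ} [IsProbabilityMeasure ν]
    [IsProbabilityMeasure μ] (hν : ν ≪ volume) (hν' : volume ≪ ν) (hμ : μ ≪ volume) :
    ∃ T : ℝ → ℝ, StrictMono T ∧ MeasurePreserving T ν μ ∧
      ∀ᵐ z ∂ν, HasDerivAt T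
        ((ν.rnDeriv volume z).toReal / (μ.rnDeriv volume (T z)).toReal) z := by
  have : NullSingletonClass ν := ⟨fun x => hν (measure_singleton x)⟩
  have : NullSingletonClass μ := ⟨fun x => hμ (measure_singleton x)⟩
  have hΦ := strictMono_cdf hν'
  have h0 : ∀ z, 0 < cdf ν z := fun z =>
    (cdf_nonneg ν (z - 1)).trans_lt (hΦ (by linarith))
  have h1 : ∀ z, cdf ν z < 1 := fun z =>
    (hΦ (by linarith : z < z + 1)).trans_le (cdf_le_one ν _)
  -- `cdf μ` may have flat pieces, so `T z` is an arbitrary choice of quantile; strict monotonicity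
  -- of `cdf ν` still orders the choices.
  choose T hT using fun z => exists_cdf_eq μ (h0 z) (h1 z)
  have hTm : StrictMono T := by
    intro x y hxy
    by_contra! h
    have := (cdf μ).mono h
    rw [hT, hT] at this
    exact absurd (hΦ hxy) (not_lt.2 this)
  have hTmeas : Measurable T := hTm.monotone.measurable
  have hmp : MeasurePreserving T ν μ := by
    refine ⟨hTmeas, ?_⟩
    have := Measure.isProbabilityMeasure_map (μ := ν) hTmeas.aemeasurable
    refine Measure.ext_of_Iic _ _ fun x => ?_
    rw [Measure.map_apply hTmeas measurableSet_Iic, ← ofReal_cdf μ]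
    rcases (cdf_nonneg μ x).eq_or_lt with hx | hx
    · have : T ⁻¹' Iic x = ∅ := by
        refine eq_empty_of_forall_notMem fun z hz => ?_
        have := (cdf μ).mono (show T z ≤ x from hz)
        rw [hT, ← hx] at this
        exact absurd (h0 z) (not_lt.2 this)
      rw [this, ← hx]; simp
    rcases (cdf_le_one μ x).eq_or_lt with hx' | hx'
    · have : T ⁻¹' Iic x = univ := by
        refine eq_univ_of_forall fun z => ?_
        by_contra hz
        have := (cdf μ).mono (not_le.1 hz).le
        rw [hT, hx'] at this
        exact absurd (h1 z) (not_lt.2 this)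
      rw [this, hx']; simp
    · obtain ⟨a, ha⟩ := exists_cdf_eq ν hx hx'
      rw [← ha, ofReal_cdf]
      refine le_antisymm (measure_mono fun z hz => ?_) ?_
      · have := (cdf μ).mono (show T z ≤ x from hz)
        rw [hT, ← ha] at this
        exact hΦ.le_iff_le.1 this
      -- `T a` may exceed `x` if `cdf μ` is flat there, so only points `z < a` surely map below `x`;
      -- `ν` has no atom at `a`.
      · rw [← measure_congr Iio_ae_eq_Iic]
        refine measure_mono fun z hz => ?_
        by_contra hz'
        have := (cdf μ).mono (not_le.1 hz').le
        rw [hT, ← ha] at this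
        exact absurd (show z < a from hz) (not_lt.2 (hΦ.le_iff_le.1 this))
  refine ⟨T, hTm, hmp, ?_⟩
  have hd : ∀ (ρ : Measure ℝ) [IsProbabilityMeasure ρ],
      ∀ᵐ x, HasDerivAt (cdf ρ) (ρ.rnDeriv volume x).toReal x := fun ρ _ => by
    have := (cdf ρ).ae_hasDerivAt
    rwa [measure_cdf] at this
  filter_upwards [hν.ae_le (hd ν), hmp.quasiMeasurePreserving.ae (hμ.ae_le (hd μ)),
    hν.ae_le hTm.monotone.ae_differentiableAt,
    hmp.quasiMeasurePreserving.ae (ae_rnDeriv_pos_lt_top hμ)] with z d1 d2 d3 hp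
  have hpos := ENNReal.toReal_pos hp.1.ne' hp.2.ne
  -- Chain rule for `cdf μ ∘ T = cdf ν`.
  have hc : HasDerivAt (cdf ν) ((μ.rnDeriv volume (T z)).toReal * deriv T z) z := by
    have := d2.comp z d3.hasDerivAt
    rwa [show (cdf μ) ∘ T = cdf ν from funext hT] at this
  rw [d1.unique hc, mul_div_cancel_left₀ _ hpos.ne']
  exact d3.hasDerivAt

/-- Change of variables on a full-measure set where `Θ` is differentiable. Its image may miss part
of the line, for instance at jumps of `Θ`, so equality can fail. -/
theorem lintegral_mul_comp_le_of_monotone {Θ Θ' : ℝ → ℝ} (hΘ : Monotone Θ)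
    (hd : ∀ᵐ x, HasDerivAt Θ (Θ' x) x) (g : ℝ → ℝ≥0∞) :
    ∫⁻ x, ENNReal.ofReal (Θ' x) * g (Θ x) ≤ ∫⁻ x, g x := by
  set s := (toMeasurable volume {x | ¬ HasDerivAt Θ (Θ' x) x})ᶜ
  have hs : MeasurableSet s := (measurableSet_toMeasurable _ _).compl
  have hs' : ∀ x ∈ s, HasDerivAt Θ (Θ' x) x := fun x hx => by
    by_contra h
    exact hx (subset_toMeasurable _ _ h)
  have hae : s =ᵐ[volume] univ := by
    rw [ae_eq_univ, compl_compl, measure_toMeasurable]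
    exact hd
  rw [← setLIntegral_univ, ← setLIntegral_congr hae,
    ← lintegral_image_eq_lintegral_deriv_mul_of_monotoneOn hs
      (fun x hx => (hs' x hx).hasDerivWithinAt) (hΘ.monotoneOn s)]
  exact setLIntegral_le_lintegral _ _

/-! ### Gaussian rotations and the entropy power inequality -/

theorem integrable_llr_gaussianReal :
    Integrable (llr (gaussianReal 0 1) volume) (gaussianReal 0 1) := by
  have h : llr (gaussianReal 0 1) volume =ᵐ[gaussianReal 0 1]
      fun x => Real.log (Real.sqrt (2 * Real.pi))⁻¹ - x ^ 2 / 2 := by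
    filter_upwards [(gaussianReal_absolutelyContinuous 0 one_ne_zero).ae_le
      (rnDeriv_gaussianReal 0 1)] with x hx
    rw [llr, hx, toReal_gaussianPDF, gaussianPDFReal,
      Real.log_mul (by positivity) (Real.exp_ne_zero _), Real.log_exp]
    simp
    ring
  refine Integrable.congr ?_ h.symm
  refine (integrable_const _).sub (Integrable.div_const ?_ 2)
  exact (memLp_id_gaussianReal (μ := 0) (v := 1) 2).integrable_sq

theorem map_rotation_gaussianReal (θ : ℝ) :
    ((gaussianReal 0 1).prod (gaussianReal 0 1)).map (ContinuousLinearMap.rotation θ)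
      = (gaussianReal 0 1).prod (gaussianReal 0 1) := by
  refine IsGaussian.map_rotation_eq_self_of_forall_strongDual_eq_zero (fun L => ?_) θ
  have : (fun x => L x) = fun x : ℝ => x * L 1 := by
    ext x
    have := L.map_smul x 1
    simpa using this
  rw [this, integral_mul_const, integral_id_gaussianReal, zero_mul]

theorem measurePreserving_rotation_gaussianReal {a b : ℝ} (h : a ^ 2 + b ^ 2 = 1) :
    MeasurePreserving (fun q : ℝ × ℝ => (a * q.2 - b * q.1, b * q.2 + a * q.1))
      ((gaussianReal 0 1).prod (gaussianReal 0 1))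
      ((gaussianReal 0 1).prod (gaussianReal 0 1)) := by
  obtain ⟨θ, h1, h2⟩ : ∃ θ, Real.cos θ = a ∧ Real.sin θ = -b := by
    have hn : ‖(⟨a, -b⟩ : ℂ)‖ = 1 := by
      rw [← sq_eq_sq₀ (norm_nonneg _) zero_le_one, Complex.sq_norm, Complex.normSq_mk]
      linarith
    have hz : (⟨a, -b⟩ : ℂ) ≠ 0 := fun h0 => by simp [h0] at hn
    exact ⟨Complex.arg ⟨a, -b⟩, by rw [Complex.cos_arg hz, hn]; simp,
      by rw [Complex.sin_arg, hn]; simp⟩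
  have hR : MeasurePreserving (ContinuousLinearMap.rotation (E := ℝ) θ)
      ((gaussianReal 0 1).prod (gaussianReal 0 1))
      ((gaussianReal 0 1).prod (gaussianReal 0 1)) :=
    ⟨by fun_prop, map_rotation_gaussianReal θ⟩
  convert! hR.comp Measure.measurePreserving_swap using 1
  ext q
  · simp [ContinuousLinearMap.rotation_apply, h1, h2]
    ring
  · simp [ContinuousLinearMap.rotation_apply, h1, h2]

/-- Entropy power inequality, linearised with weights `l + m = 1`, for sums of independent
real variables. -/
theorem integral_llr_conv_le_weighted {μ₁ μ₂ : Measure ℝ} [IsProbabilityMeasure μ₁]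
    [IsProbabilityMeasure μ₂] (h₁ : μ₁ ≪ volume) (h₂ : μ₂ ≪ volume) (h : μ₁ ∗ μ₂ ≪ volume)
    (i₁ : Integrable (llr μ₁ volume) μ₁) (i₂ : Integrable (llr μ₂ volume) μ₂)
    (i : Integrable (llr (μ₁ ∗ μ₂) volume) (μ₁ ∗ μ₂)) {l m : ℝ} (hl : 0 < l) (hm : 0 < m)
    (hlm : l + m = 1) :
    ∫ x, llr (μ₁ ∗ μ₂) volume x ∂(μ₁ ∗ μ₂) ≤ l * ∫ x, llr μ₁ volume x ∂μ₁
      + m * ∫ x, llr μ₂ volume x ∂μ₂ + 1 / 2 * (l * Real.log l + m * Real.log m) := by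
  set γ := gaussianReal 0 1 with hγ
  have hγ1 : γ ≪ volume := gaussianReal_absolutelyContinuous 0 one_ne_zero
  have hγ2 : volume ≪ γ := gaussianReal_absolutelyContinuous' 0 one_ne_zero
  obtain ⟨T₁, hT₁, mp₁, d₁⟩ := exists_strictMono_transport hγ1 hγ2 h₁
  obtain ⟨T₂, hT₂, mp₂, d₂⟩ := exists_strictMono_transport hγ1 hγ2 h₂
  set a := Real.sqrt l with ha
  set b := Real.sqrt m with hb
  have ha0 : 0 < a := Real.sqrt_pos.2 hl
  have hb0 : 0 < b := Real.sqrt_pos.2 hm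
  have hal : a ^ 2 = l := Real.sq_sqrt hl.le
  have hbm : b ^ 2 = m := Real.sq_sqrt hm.le
  have mpR := measurePreserving_rotation_gaussianReal (a := a) (b := b) (by rw [hal, hbm, hlm])
  rw [← hγ] at mpR
  have mpz₁ : MeasurePreserving (fun q : ℝ × ℝ => a * q.2 - b * q.1) (γ.prod γ) γ :=
    measurePreserving_fst.comp mpR
  have mpz₂ : MeasurePreserving (fun q : ℝ × ℝ => b * q.2 + a * q.1) (γ.prod γ) γ :=
    measurePreserving_snd.comp mpR
  have mpx : MeasurePreserving (fun q : ℝ × ℝ => q.2) (γ.prod γ) γ := measurePreserving_snd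
  set S : ℝ × ℝ → ℝ := fun q => T₁ (a * q.2 - b * q.1) + T₂ (b * q.2 + a * q.1)
  have mpS : MeasurePreserving S (γ.prod γ) (μ₁ ∗ μ₂) := by
    have hadd : MeasurePreserving (fun p : ℝ × ℝ => p.1 + p.2) (μ₁.prod μ₂) (μ₁ ∗ μ₂) :=
      ⟨by fun_prop, rfl⟩
    exact hadd.comp ((mp₁.prod mp₂).comp mpR)
  set D₁ : ℝ → ℝ := fun z => (γ.rnDeriv volume z).toReal / (μ₁.rnDeriv volume (T₁ z)).toReal
  set D₂ : ℝ → ℝ := fun z => (γ.rnDeriv volume z).toReal / (μ₂.rnDeriv volume (T₂ z)).toReal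
  have mT₁ : Measurable T₁ := mp₁.measurable
  have mT₂ : Measurable T₂ := mp₂.measurable
  have mD₁ : Measurable D₁ := by fun_prop
  have mD₂ : Measurable D₂ := by fun_prop
  have iγ : Integrable (llr γ volume) γ := integrable_llr_gaussianReal
  have I0 := mpS.integrable_comp_of_integrable i
  have I1 := mpz₁.integrable_comp_of_integrable iγ
  have I2 := mpz₂.integrable_comp_of_integrable iγ
  have I3 := (mp₁.comp mpz₁).integrable_comp_of_integrable i₁
  have I4 := (mp₂.comp mpz₂).integrable_comp_of_integrable i₂
  have I5 := mpx.integrable_comp_of_integrable iγ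
  have E0 := mpS.integral_comp_of_measurable (measurable_llr (μ₁ ∗ μ₂) volume)
  have E1 := mpz₁.integral_comp_of_measurable (measurable_llr γ volume)
  have E2 := mpz₂.integral_comp_of_measurable (measurable_llr γ volume)
  have E3 := (mp₁.comp mpz₁).integral_comp_of_measurable
    (measurable_llr μ₁ volume)
  have E4 := (mp₂.comp mpz₂).integral_comp_of_measurable
    (measurable_llr μ₂ volume)
  have E5 := mpx.integral_comp_of_measurable (measurable_llr γ volume)
  simp only [Function.comp_def] at I0 I1 I2 I3 I4 I5 E0 E1 E2 E3 E4 E5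
  have J1 := (I1.sub I3).const_mul l
  have J2 := (I2.sub I4).const_mul m
  have J3 := I0.add (J1.add J2)
  have J4 := J3.sub I5
  have J5 := J4.sub (integrable_const (l * Real.log a + m * Real.log b))
  have key := integral_nonpos_of_lintegral_exp_le_one J5 ?_
  · simp only [Pi.sub_apply, Pi.add_apply] at key
    rw [integral_sub (by exact J4) (integrable_const _), integral_sub (by exact J3) I5,
      integral_add I0 (by exact J1.add J2), integral_add (by exact J1) (by exact J2),
      integral_const_mul, integral_const_mul, integral_sub I1 I3, integral_sub I2 I4,
      E0, E1, E2, E3, E4, E5] at key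
    simp only [integral_const, probReal_univ, one_smul] at key
    rw [ha, hb, Real.log_sqrt hl.le, Real.log_sqrt hm.le] at key
    -- The Gaussian entropy terms carry total weight `l + m - 1 = 0` and cancel.
    obtain rfl : m = 1 - l := by linarith
    linarith
  calc _ ≤ ∫⁻ q : ℝ × ℝ, ENNReal.ofReal (a * D₁ (a * q.2 - b * q.1) + b * D₂ (b * q.2 + a * q.1))
          * (μ₁ ∗ μ₂).rnDeriv volume (S q) / γ.rnDeriv volume q.2 ∂(γ.prod γ) := by
        refine lintegral_mono_ae ?_
        filter_upwards [mpS.quasiMeasurePreserving.ae (ae_rnDeriv_pos_lt_top h),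
          mpz₁.quasiMeasurePreserving.ae (ae_rnDeriv_pos_lt_top hγ1),
          mpz₂.quasiMeasurePreserving.ae (ae_rnDeriv_pos_lt_top hγ1),
          (mp₁.comp mpz₁).quasiMeasurePreserving.ae (ae_rnDeriv_pos_lt_top h₁),
          (mp₂.comp mpz₂).quasiMeasurePreserving.ae (ae_rnDeriv_pos_lt_top h₂),
          mpx.quasiMeasurePreserving.ae (ae_rnDeriv_pos_lt_top hγ1)] with q p0 p1 p2 p3 p4 p5
        simp only [Function.comp_def] at p3 p4
        have r0 := ENNReal.toReal_pos p0.1.ne' p0.2.ne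
        have r1 := ENNReal.toReal_pos p1.1.ne' p1.2.ne
        have r2 := ENNReal.toReal_pos p2.1.ne' p2.2.ne
        have r3 := ENNReal.toReal_pos p3.1.ne' p3.2.ne
        have r4 := ENNReal.toReal_pos p4.1.ne' p4.2.ne
        have r5 := ENNReal.toReal_pos p5.1.ne' p5.2.ne
        have q1 : 0 < D₁ (a * q.2 - b * q.1) := div_pos r1 r3
        have q2 : 0 < D₂ (b * q.2 + a * q.1) := div_pos r2 r4
        have l1 : llr γ volume (a * q.2 - b * q.1) - llr μ₁ volume (T₁ (a * q.2 - b * q.1))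
            = Real.log (D₁ (a * q.2 - b * q.1)) := (Real.log_div r1.ne' r3.ne').symm
        have l2 : llr γ volume (b * q.2 + a * q.1) - llr μ₂ volume (T₂ (b * q.2 + a * q.1))
            = Real.log (D₂ (b * q.2 + a * q.1)) := (Real.log_div r2.ne' r4.ne').symm
        simp only [Pi.sub_apply, Pi.add_apply]
        rw [l1, l2]
        generalize D₁ (a * q.2 - b * q.1) = x at q1 ⊢
        generalize D₂ (b * q.2 + a * q.1) = y at q2 ⊢
        rw [← ENNReal.ofReal_toReal p0.2.ne, ← ENNReal.ofReal_toReal p5.2.ne,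
          ← ENNReal.ofReal_mul (by positivity), ← ENNReal.ofReal_div_of_pos r5]
        refine ENNReal.ofReal_le_ofReal ?_
        rw [← Real.le_log_iff_exp_le (by positivity), Real.log_div (by positivity) r5.ne',
          Real.log_mul (by positivity) r0.ne']
        -- Dividing by `a = √l` and `b = √m` turns the convex combination into `a * x + b * y`, the
        -- derivative of `S` in its second coordinate, at the cost of the constant `l log a + m log
        -- b`.
        have hc := strictConcaveOn_log_Ioi.concaveOn.2 (show x / a ∈ Ioi 0 from div_pos q1 ha0)
          (show y / b ∈ Ioi 0 from div_pos q2 hb0) hl.le hm.le hlm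
        simp only [smul_eq_mul] at hc
        rw [Real.log_div q1.ne' ha0.ne', Real.log_div q2.ne' hb0.ne',
          show l * (x / a) + m * (y / b) = a * x + b * y by
            rw [← hal, ← hbm]; field_simp] at hc
        simp only [llr]
        linarith
    _ = ∫⁻ y, ∫⁻ x, ENNReal.ofReal (a * D₁ (a * x - b * y) + b * D₂ (b * x + a * y))
          * (μ₁ ∗ μ₂).rnDeriv volume (S (y, x)) / γ.rnDeriv volume x ∂γ ∂γ :=
        lintegral_prod _ (by fun_prop)
    _ ≤ ∫⁻ y, (∫⁻ x, ENNReal.ofReal (a * D₁ (a * x - b * y) + b * D₂ (b * x + a * y))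
          * (μ₁ ∗ μ₂).rnDeriv volume (S (y, x))) ∂γ :=
        lintegral_mono fun y => lintegral_div_rnDeriv_le hγ1 (by fun_prop)
    _ ≤ ∫⁻ y, (∫⁻ x, (μ₁ ∗ μ₂).rnDeriv volume x) ∂γ := by
        refine lintegral_mono_ae ?_
        filter_upwards [Measure.ae_ae_of_ae_prod
          ((mpz₁.quasiMeasurePreserving.ae d₁).and (mpz₂.quasiMeasurePreserving.ae d₂))] with y hy
        refine lintegral_mul_comp_le_of_monotone (Θ := fun x => S (y, x)) ?_ ?_ _
        · intro x x' hx
          refine add_le_add (hT₁.monotone ?_) (hT₂.monotone ?_) <;> dsimp only <;> gcongr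
        · filter_upwards [hγ2.ae_le hy] with x hx
          have e1 : HasDerivAt (fun x => a * x - b * y) a x := by
            simpa using ((hasDerivAt_id x).const_mul a).sub_const (b * y)
          have e2 : HasDerivAt (fun x => b * x + a * y) b x := by
            simpa using ((hasDerivAt_id x).const_mul b).add_const (a * y)
          have := (hx.1.comp x e1).add (hx.2.comp x e2)
          rw [mul_comm _ a, mul_comm _ b] at this
          exact this
    _ ≤ 1 := by
        rw [lintegral_const, measure_univ, mul_one]
        exact Measure.lintegral_rnDeriv_le.trans_eq measure_univ

/-! ### Entropy along a Lévy process -/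

section DifferentialEntropy

variable {Ω : Type*} [MeasurableSpace Ω] {P : Measure Ω}

theorem HasFiniteDifferentialEntropy.map_absolutelyContinuous {X : Ω → ℝ}
    (h : HasFiniteDifferentialEntropy X P) : P.map X ≪ volume :=
  h.1.absolutelyContinuous'

variable [IsProbabilityMeasure P]

theorem HasFiniteDifferentialEntropy.integrable_llr {X : Ω → ℝ}
    (h : HasFiniteDifferentialEntropy X P) : Integrable (llr (P.map X) volume) (P.map X) :=
  (integrable_rnDeriv_mul_log_iff h.map_absolutelyContinuous).1 h.2

theorem HasFiniteDifferentialEntropy.differentialEntropy_eq {X : Ω → ℝ}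
    (h : HasFiniteDifferentialEntropy X P) :
    differentialEntropy X P = -∫ x, llr (P.map X) volume x ∂(P.map X) :=
  congrArg Neg.neg (integral_rnDeriv_mul_log h.map_absolutelyContinuous)

end DifferentialEntropy

namespace IsLevyProcess

variable {Ω : Type*} [MeasurableSpace Ω] {P : Measure Ω} [IsProbabilityMeasure P]
  {L : ℝ≥0 → Ω → ℝ}

theorem map_add (hL : IsLevyProcess L P) (s t : ℝ≥0) :
    P.map (L (s + t)) = P.map (L s) ∗ P.map (L t) := by
  have hi : IndepFun (L s) (L (s + t) - L s) P :=
    hL.indep.indepFun_eval_sub zero_le le_self_add hL.zero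
  have h := hi.map_add_eq_map_conv_map (hL.measurable s)
    ((hL.measurable _).sub (hL.measurable s))
  rw [add_sub_cancel] at h
  rw [h, (hL.stationary t s).map_eq]
  rfl

theorem differentialEntropy_monotoneOn (hL : IsLevyProcess L P)
    (hent : ∀ t : ℝ≥0, 0 < t → HasFiniteDifferentialEntropy (L t) P) :
    MonotoneOn (fun t : ℝ≥0 => differentialEntropy (L t) P) (Ioi 0) := by
  intro s hs t ht hst
  obtain ⟨r, rfl⟩ := exists_add_of_le hst
  have := fun u => Measure.isProbabilityMeasure_map (μ := P) (hL.measurable u).aemeasurable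
  have hadd := hL.map_add s r
  have h1 := hent s hs
  have h2 := hent (s + r) ht
  have a2 := h2.map_absolutelyContinuous
  have i2 := h2.integrable_llr
  dsimp only
  rw [h1.differentialEntropy_eq, h2.differentialEntropy_eq, neg_le_neg_iff]
  rw [hadd] at a2 i2 ⊢
  exact integral_llr_conv_le h1.map_absolutelyContinuous a2 h1.integrable_llr i2

theorem differentialEntropy_add_ge (hL : IsLevyProcess L P)
    (hent : ∀ t : ℝ≥0, 0 < t → HasFiniteDifferentialEntropy (L t) P) {s t : ℝ≥0} (hs : 0 < s)
    (ht : 0 < t) {l m : ℝ} (hl : 0 < l) (hm : 0 < m) (hlm : l + m = 1) :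
    l * differentialEntropy (L s) P + m * differentialEntropy (L t) P
      - 1 / 2 * (l * Real.log l + m * Real.log m) ≤ differentialEntropy (L (s + t)) P := by
  have := fun u => Measure.isProbabilityMeasure_map (μ := P) (hL.measurable u).aemeasurable
  have hadd := hL.map_add s t
  have h1 := hent s hs
  have h2 := hent t ht
  have h3 := hent (s + t) (by positivity)
  have a3 := h3.map_absolutelyContinuous
  have i3 := h3.integrable_llr
  rw [h1.differentialEntropy_eq, h2.differentialEntropy_eq, h3.differentialEntropy_eq]
  rw [hadd] at a3 i3 ⊢
  have := integral_llr_conv_le_weighted h1.map_absolutelyContinuous h2.map_absolutelyContinuous a3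
    h1.integrable_llr h2.integrable_llr i3 hl hm hlm
  linarith

theorem differentialEntropy_nsmul_ge (hL : IsLevyProcess L P)
    (hent : ∀ t : ℝ≥0, 0 < t → HasFiniteDifferentialEntropy (L t) P) {t : ℝ≥0} (ht : 0 < t)
    {n : ℕ} (hn : 1 ≤ n) :
    differentialEntropy (L t) P + 1 / 2 * Real.log n ≤ differentialEntropy (L (n * t)) P := by
  induction n, hn using Nat.le_induction with
  | base => simp
  | succ n hn ih =>
    have hn0 : (0 : ℝ) < n := by exact_mod_cast hn
    have hn0' : (0 : ℝ≥0) < n := by exact_mod_cast hn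
    -- Weights proportional to the durations `n * t` and `t` make the gain exactly `½ log (n + 1)`.
    have h := hL.differentialEntropy_add_ge hent (s := n * t) (t := t) (by positivity) ht
      (l := n / (n + 1)) (m := 1 / (n + 1)) (by positivity) (by positivity) (by field_simp)
    rw [← add_one_mul] at h
    push_cast
    refine le_trans ?_ h
    rw [Real.log_div (by positivity) (by positivity), Real.log_div (by positivity) (by positivity),
      Real.log_one]
    have := mul_le_mul_of_nonneg_left ih (show (0 : ℝ) ≤ n / (n + 1) by positivity)
    have e : (n : ℝ) / (n + 1) = 1 - 1 / (n + 1) := by field_simp; ring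
    rw [e] at this ⊢
    linarith

end IsLevyProcess

theorem proposition3p6 {Ω : Type*} [MeasurableSpace Ω] (P : Measure Ω) [IsProbabilityMeasure P]
    (L : ℝ≥0 → Ω → ℝ) (hL : IsLevyProcess L P)
    (hent : ∀ t : ℝ≥0, 0 < t → HasFiniteDifferentialEntropy (L t) P) :
    MonotoneOn (fun t : ℝ≥0 => differentialEntropy (L t) P) (Ioi 0) ∧
    ∀ t : ℝ≥0, 0 < t → t < 1 →
      differentialEntropy (L t) P ≤
        differentialEntropy (L 1) P + 1 / 2 * Real.log ((t : ℝ) / (1 - (t : ℝ))) := by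
  have hmono := hL.differentialEntropy_monotoneOn hent
  refine ⟨hmono, fun t ht ht1 => ?_⟩
  have ht' : (0 : ℝ) < t := ht
  have ht1' : (t : ℝ) < 1 := ht1
  set n := ⌊(1 / t : ℝ≥0)⌋₊
  have hn1 : 1 ≤ n := Nat.le_floor (by simpa using (one_le_inv₀ ht).2 ht1.le)
  have hn0 : (0 : ℝ≥0) < n := by exact_mod_cast hn1
  have hle : (n : ℝ≥0) * t ≤ 1 := (le_div_iff₀ ht).1 (Nat.floor_le zero_le)
  have hlt : (1 : ℝ) < (n + 1) * t := by
    have := (div_lt_iff₀ ht).1 (Nat.lt_floor_add_one (1 / t : ℝ≥0))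
    exact_mod_cast this
  have h1 := hL.differentialEntropy_nsmul_ge hent ht hn1
  have h2 : differentialEntropy (L (n * t)) P ≤ differentialEntropy (L 1) P :=
    hmono (show 0 < (n : ℝ≥0) * t by positivity) (show (0 : ℝ≥0) < 1 from one_pos) hle
  -- From `(n + 1) * t > 1`, that is, `n > 1 / t - 1`.
  have h3 : Real.log ((1 - t) / t) ≤ Real.log n := by
    refine Real.log_le_log (div_pos (by linarith) ht') ?_
    rw [div_le_iff₀ ht']
    linarith
  rw [← inv_div (1 - (t : ℝ)) (t : ℝ), Real.log_inv]
  linarith
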